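/- **Definitions.** Let $d,k\ge 0$ be integers and let $\mathcal D^k(\mathbf R^d)$ be the space of smooth compactly supported differential $k$-forms on $\mathbf R^d$ with its usual locally convex topology. A $k$-current is a continuous linear functional $T:\mathcal D^k(\mathbf R^d)\to\mathbf R$; its boundary is the $(k-1)$-current $\partial T(\omega)=T(d\omega)$ (with $\partial T=0$ if $k=0$), and its support $\operatorname{spt}T$ is the complement of the largest open set $U$ such that $T(\omega)=0$ for all $\omega$ supported in $U$. The comass of a $k$-covector $w$ is $\|w\|^*=\sup\{\langle w,v\rangle : v \text{ a simple } k\text{-vector},\ |v|=1\}$, where $|\cdot|$ is the Euclidean norm on $k$-vectors. The mass of $T$ is $\mathbb M(T)=\sup\{T(\omega):\omega\in\mathcal D^k(\mathbf R^d),\ \|\omega(x)\|^*\le 1 \text{ for all } x\}$. For a compact set $\mathcal X\subset\mathbf R^d$, $\mathbf N_{k,\mathcal X}(\mathbf R^d)$ denotes the set of $k$-currents $T$ with $\mathbb M(T)<\infty$, $\mathbb M(\partial T)<\infty$ and $\operatorname{spt}T\subset\mathcal X$. For $\lambda>0$ the flat norm is $$\mathbb F_\lambda(T)=\sup\{T(\omega):\omega\in\mathcal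 D^k(\mathbf R^d),\ \|\omega(x)\|^*\le\lambda,\ \|d\omega(x)\|^*\le 1\text{ for all }x\}\in[0,\infty],$$ and the flat metric is $\mathbb F_\lambda(S,T)=\mathbb F_\lambda(S-T)$. **Proposition.** Let $\mathcal X\subset\mathbf R^d$ be compact, let $c>0$ and $\lambda>0$, and let $(T_j)$ be a sequence in $\mathbf N_{k,\mathcal X}(\mathbf R^d)$ with $\mathbb M(T_j)+\mathbb M(\partial T_j)<c$ for all $j$. Then for every $k$-current $T$ in $\mathbf R^d$, $$\mathbb F_\lambda(T,T_j)\to 0\quad\text{if and only if}\quad T_j(\omega)\to T(\omega)\ \text{ for all } \omega\in\mathcal D^k(\mathbf R^d)$$ (that is, if and only if $T_j$ converges weak* to $T$). -/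

import Mathlib

open Filter Topology
open scoped Distributions ENNReal

noncomputable section

namespace GMT

/-- Euclidean space `ℝ^d`. -/
abbrev Rd (d : ℕ) : Type := EuclideanSpace ℝ (Fin d)

/-- `k`-covectors of `ℝ^d`, i.e. alternating `k`-linear forms. -/
abbrev Covector (d k : ℕ) : Type := Rd d [⋀^Fin k]→L[ℝ] ℝ

/-- The pairing `⟨w, ξ⟩` of a `k`-covector and a `k`-vector; it is linear in `ξ` and satisfies
`⟨w, v₁ ∧ ⋯ ∧ vₖ⟩ = w (v₁, …, vₖ)`. -/
def pairing {d k : ℕ} (w : Covector d k) (ξ : ⋀[ℝ]^k (Rd d)) : ℝ :=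
  exteriorPower.alternatingMapLinearEquiv w.toAlternatingMap ξ

/-- A `k`-vector is simple if it is a multiple of a product `v₁ ∧ ⋯ ∧ vₖ`. The scalar matters
only for `k = 0`, where every `0`-vector (i.e. real number) is simple. -/
def IsSimple {d k : ℕ} (ξ : ⋀[ℝ]^k (Rd d)) : Prop :=
  ∃ (a : ℝ) (v : Fin k → Rd d), ξ = a • exteriorPower.ιMulti ℝ k v

/-- The comass norm of a `k`-covector. The norm `‖ξ‖` is the Euclidean norm on `k`-vectors, for
which the `e_{i₁} ∧ ⋯ ∧ e_{iₖ}` with `i₁ < ⋯ < iₖ` are orthonormal. -/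
def comass {d k : ℕ} (w : Covector d k) : ℝ :=
  sSup {r : ℝ | ∃ ξ : ⋀[ℝ]^k (Rd d), IsSimple ξ ∧ ‖ξ‖ = 1 ∧ r = pairing w ξ}

/-- The supremum defining the comass is taken over a bounded set. -/
theorem bddAbove_comass {d k : ℕ} (w : Covector d k) :
    BddAbove {r : ℝ | ∃ ξ : ⋀[ℝ]^k (Rd d), IsSimple ξ ∧ ‖ξ‖ = 1 ∧ r = pairing w ξ} := by
  let f : (⋀[ℝ]^k (Rd d)) →L[ℝ] ℝ := LinearMap.toContinuousLinearMap
    (exteriorPower.alternatingMapLinearEquiv w.toAlternatingMap)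
  refine ⟨‖f‖, ?_⟩
  rintro r ⟨ξ, -, h1, rfl⟩
  have h2 := f.le_opNorm ξ
  rw [h1, mul_one] at h2
  exact (le_abs_self _).trans h2

/-- The space `𝓓^k(ℝ^d)` of smooth compactly supported differential `k`-forms, with its usual
(inductive limit) locally convex topology. -/
abbrev Form (d k : ℕ) : Type := 𝓓((⊤ : TopologicalSpace.Opens (Rd d)), Covector d k)

/-- The exterior derivative as a continuous linear map on smooth compactly supported forms. -/
def extD (d k : ℕ) : Form d k →L[ℝ] Form d (k + 1) :=
  (TestFunction.postcompCLM
    (ContinuousAlternatingMap.alternatizeUncurryFinCLM ℝ (Rd d) ℝ)).comp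
    (TestFunction.fderivCLM ℝ (⊤ : ℕ∞) (⊤ : ℕ∞))

theorem extD_apply {d k : ℕ} (ω : Form d k) (x : Rd d) :
    extD d k ω x = extDeriv (ω : Rd d → Covector d k) x := by
  simp [extD, extDeriv]

/-- `k`-currents in `ℝ^d`: continuous linear functionals on smooth compactly supported
`k`-forms. -/
abbrev Current (d k : ℕ) : Type := Form d k →L[ℝ] ℝ

/-- The boundary of a `(k+1)`-current, `∂T(ω) = T(dω)`. -/
def boundary {d k : ℕ} (T : Current d (k + 1)) : Current d k := T.comp (extD d k)

/-- The mass `sup {T(ω) : ‖ω(x)‖* ≤ 1 for all x}` of a current, in `[0, ∞]`. Since `ω = 0` is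
admissible, truncating negative values at `0` does not change the supremum. -/
def mass {d k : ℕ} (T : Current d k) : ℝ≥0∞ :=
  ⨆ (ω : Form d k) (_ : ∀ x, comass (ω x) ≤ 1), ENNReal.ofReal (T ω)

/-- The mass of the boundary of a `k`-current; the boundary of a `0`-current is zero. -/
def boundaryMass {d : ℕ} : {k : ℕ} → Current d k → ℝ≥0∞
  | 0, _ => 0
  | _ + 1, T => mass (boundary T)

/-- The support of a current: the complement of the largest open set on which it vanishes. -/
def spt {d k : ℕ} (T : Current d k) : Set (Rd d) := Distribution.dsupport (T : Form d k → ℝ)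

/-- Normal `k`-currents (finite mass and finite boundary mass) supported in `X`. -/
def normalCurrents {d : ℕ} (k : ℕ) (X : Set (Rd d)) : Set (Current d k) :=
  {T | mass T < ∞ ∧ boundaryMass T < ∞ ∧ spt T ⊆ X}

/-- The flat norm with scale `l`:
`sup {T(ω) : ‖ω(x)‖* ≤ l and ‖dω(x)‖* ≤ 1 for all x}`, in `[0, ∞]`. For `l ≥ 0` the form `ω = 0`
is admissible, so truncating negative values at `0` does not change the supremum. -/
def flatNorm {d k : ℕ} (l : ℝ) (T : Current d k) : ℝ≥0∞ :=
  ⨆ (ω : Form d k) (_ : ∀ x, comass (ω x) ≤ l ∧ comass (extD d k ω x) ≤ 1),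
    ENNReal.ofReal (T ω)

/-- The flat metric with scale `l`. -/
def flatDist {d k : ℕ} (l : ℝ) (S T : Current d k) : ℝ≥0∞ := flatNorm l (S - T)

/-- Weak* convergence of a sequence of currents. -/
def WeakStarTendsto {d k : ℕ} (Tseq : ℕ → Current d k) (T : Current d k) : Prop :=
  ∀ ω : Form d k, Tendsto (fun j => Tseq j ω) atTop (𝓝 (T ω))

end GMT

end

noncomputable section

namespace GMT

open MeasureTheory BoundedContinuousFunction

/-! ### Translation and mollification of test functions under sup-norm bounded functionals. -/

section TestFunction

variable {E F : Type*} [NormedAddCommGroup E] [NormedSpace ℝ E]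
  [NormedAddCommGroup F] [NormedSpace ℝ F]

local notation "𝓓E" => TestFunction (⊤ : TopologicalSpace.Opens E) F (⊤ : ℕ∞)

/-! Flat convergence gives weak* convergence by scaling: each form has a positive multiple
admissible for the flat norm, and ω and -ω together control absolute values.

For the converse put S_j = T - T_j and let ρ be an even bump of integral one and small radius r. For
admissible ω, S_j(ω) differs from the ρ-average of S_j over the translates of ω by O(r), uniformly
in j and ω: by Cartan's formula the derivative along z is d ι_z + ι_z d, which the bounds on S_j and
∂S_j control through the sup norms of ω and dω alone (`SupBounded.abs_translate_sub_le_of_norm_le`).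
In a basis b_i of covectors the average becomes Σ ∫ ω_i(y) S_j(ρ(· - y) b_i) dy
(`SupBounded.integral_translate_eq`), so it is at most a constant times the sum of the L¹ norms of y
↦ S_j(ρ(· - y) b_i). These functions do not involve ω, are uniformly bounded, vanish off a fixed
compact set and tend to 0 pointwise, hence in L¹ (`tendsto_integral_abs_translate`). One fixes r
first, then takes j large. -/

/-- The translate `x ↦ f (x + z)` of a test function. -/
def translate (z : E) (f : 𝓓E) : 𝓓E where
  toFun x := f (x + z)
  contDiff' := f.contDiff.comp (contDiff_id.add contDiff_const)
  hasCompactSupport' := f.hasCompactSupport.comp_homeomorph (Homeomorph.addRight z)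
  tsupport_subset' := Set.subset_univ _

@[simp]
theorem translate_apply (z : E) (f : 𝓓E) (x : E) : translate z f x = f (x + z) := rfl

/-- The product of a test function with a smooth function. -/
def smoothSMul (χ : E → ℝ) (hχ : ContDiff ℝ (⊤ : ℕ∞) χ) (f : 𝓓E) : 𝓓E where
  toFun x := χ x • f x
  contDiff' := hχ.smul f.contDiff
  hasCompactSupport' := f.hasCompactSupport.smul_left (f := χ)
  tsupport_subset' := Set.subset_univ _

theorem continuous_toBCF_translate (f : 𝓓E) :
    Continuous fun z : E => TestFunction.toBoundedContinuousFunctionCLM ℝ (translate z f) := by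
  have huc : UniformContinuous f :=
    f.hasCompactSupport.uniformContinuous_of_continuous f.continuous
  rw [Metric.continuous_iff]
  intro z ε hε
  obtain ⟨δ, hδ, h⟩ := Metric.uniformContinuous_iff.1 huc (ε / 2) (half_pos hε)
  refine ⟨δ, hδ, fun y hy => ?_⟩
  refine lt_of_le_of_lt ((BoundedContinuousFunction.dist_le (half_pos hε).le).2 fun x => ?_)
    (half_lt_self hε)
  exact (h (a := x + y) (b := x + z) (by simpa using hy)).le

/-- A functional on test functions that is bounded for the supremum norm by `C`. -/
def SupBounded (C : ℝ) (S : 𝓓E →L[ℝ] ℝ) : Prop :=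
  ∀ (ω : 𝓓E) (M : ℝ), 0 ≤ M → (∀ x, ‖ω x‖ ≤ M) → |S ω| ≤ C * M

/-- Hahn–Banach in the sup norm. The extension lives on a normed space of functions, so it commutes
with Bochner integrals of translates, which the test function space itself does not offer directly.
-/
theorem SupBounded.exists_extension {C : ℝ} {S : 𝓓E →L[ℝ] ℝ} (hS : SupBounded C S) :
    ∃ G : (E →ᵇ F) →L[ℝ] ℝ,
      ∀ ω : 𝓓E, G (TestFunction.toBoundedContinuousFunctionCLM ℝ ω) = S ω := by
  let J : 𝓓E →ₗ[ℝ] (E →ᵇ F) := (TestFunction.toBoundedContinuousFunctionCLM ℝ).toLinearMap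
  have hJ : Function.Injective J := TestFunction.injective_toBoundedContinuousFunctionCLM ℝ
  let e := LinearEquiv.ofInjective J hJ
  let f : StrongDual ℝ (LinearMap.range J) :=
    LinearMap.mkContinuous (S.toLinearMap ∘ₗ e.symm.toLinearMap) C (by
      intro p
      obtain ⟨ω, rfl⟩ := e.surjective p
      simp only [LinearMap.comp_apply, LinearEquiv.coe_coe, LinearEquiv.symm_apply_apply]
      exact hS ω _ (norm_nonneg _) fun x => (J ω).norm_coe_le_norm x)
  obtain ⟨G, hG, -⟩ := exists_extension_norm_eq _ f
  refine ⟨G, fun ω => ?_⟩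
  have h := hG (e ω)
  have h2 : f (e ω) = S ω := by simp [f]
  exact h.trans h2

theorem translate_sub_eq_integral [CompleteSpace F] (ω : 𝓓E) (z : E) :
    TestFunction.toBoundedContinuousFunctionCLM ℝ (translate z ω) -
        TestFunction.toBoundedContinuousFunctionCLM ℝ ω =
      ∫ t in (0 : ℝ)..1, TestFunction.toBoundedContinuousFunctionCLM ℝ
        (translate (t • z) (TestFunction.lineDerivCLM ℝ z ω : 𝓓E)) := by
  have hc : Continuous fun t : ℝ => TestFunction.toBoundedContinuousFunctionCLM ℝ
        (translate (t • z) (TestFunction.lineDerivCLM ℝ z ω : 𝓓E)) :=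
    (continuous_toBCF_translate _).comp (by fun_prop)
  ext x
  have h1 := (BoundedContinuousFunction.evalCLM ℝ x (β := F)).intervalIntegral_comp_comm
    (hc.intervalIntegrable (μ := volume) 0 1)
  rw [BoundedContinuousFunction.evalCLM_apply] at h1
  rw [← h1]
  have hd : Differentiable ℝ ω := ω.contDiff.differentiable (by simp)
  have h2 : ∀ t : ℝ, HasDerivAt (fun t : ℝ => ω (x + t • z)) (fderiv ℝ ω (x + t • z) z) t := by
    intro t
    have h3 : HasDerivAt (fun t : ℝ => x + t • z) z t := by
      simpa using ((hasDerivAt_id t).smul_const z).const_add x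
    exact (hd _).hasFDerivAt.comp_hasDerivAt t h3
  have h4 : Continuous fun t : ℝ => fderiv ℝ ω (x + t • z) z := by
    have := ω.contDiff.continuous_fderiv (by simp)
    fun_prop
  have h5 := intervalIntegral.integral_eq_sub_of_hasDerivAt (fun t _ => h2 t)
    (h4.intervalIntegrable 0 1)
  simp only [one_smul, zero_smul, add_zero] at h5
  simp only [BoundedContinuousFunction.sub_apply]
  refine h5.symm.trans ?_
  refine intervalIntegral.integral_congr fun t _ => ?_
  simp [(hd _).lineDeriv_eq_fderiv]

/-- Mean value inequality for translations under a functional bounded in the supremum norm. -/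
theorem SupBounded.abs_translate_sub_le [CompleteSpace F] {C : ℝ} {S : 𝓓E →L[ℝ] ℝ}
    (hS : SupBounded C S) (ω : 𝓓E) (z : E) {A : ℝ}
    (hA : ∀ t : ℝ, |S (translate (t • z) (TestFunction.lineDerivCLM ℝ z ω : 𝓓E))| ≤ A) :
    |S (translate z ω) - S ω| ≤ A := by
  obtain ⟨G, hG⟩ := hS.exists_extension
  have hc : Continuous fun t : ℝ => TestFunction.toBoundedContinuousFunctionCLM ℝ
        (translate (t • z) (TestFunction.lineDerivCLM ℝ z ω : 𝓓E)) :=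
    (continuous_toBCF_translate _).comp (by fun_prop)
  have h := congrArg G (translate_sub_eq_integral ω z)
  rw [map_sub, hG, hG,
    ← G.intervalIntegral_comp_comm (hc.intervalIntegrable (μ := volume) 0 1)] at h
  rw [h]
  have := intervalIntegral.norm_integral_le_of_norm_le_const (a := 0) (b := 1) (C := A)
    (f := fun t : ℝ => G (TestFunction.toBoundedContinuousFunctionCLM ℝ
        (translate (t • z) (TestFunction.lineDerivCLM ℝ z ω : 𝓓E))))
    fun t _ => by simpa only [hG, Real.norm_eq_abs] using hA t
  simpa using this

theorem SupBounded.continuous_translate {C : ℝ} {S : 𝓓E →L[ℝ] ℝ}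
    (hS : SupBounded C S) (ω : 𝓓E) : Continuous fun z => S (translate z ω) := by
  obtain ⟨G, hG⟩ := hS.exists_extension
  simp only [← hG]
  exact G.continuous.comp (continuous_toBCF_translate ω)

/-- A compactly supported smooth scalar function times a fixed vector. -/
def bumpVector (ρ : E → ℝ) (hρ : ContDiff ℝ (⊤ : ℕ∞) ρ) (hs : HasCompactSupport ρ) (b : F) :
    𝓓E where
  toFun x := ρ x • b
  contDiff' := hρ.smul contDiff_const
  hasCompactSupport' := hs.smul_right (f' := fun _ => b)
  tsupport_subset' := Set.subset_univ _

/-- Mollifying a test function before applying a functional amounts to integrating the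
coefficients of the test function against the values of the functional on translated bumps. -/
theorem SupBounded.integral_translate_eq [FiniteDimensional ℝ E] [MeasurableSpace E]
    [BorelSpace E] {μ : Measure E} [μ.IsAddHaarMeasure] [FiniteDimensional ℝ F]
    {ι : Type*} [Fintype ι] (b : Module.Basis ι ℝ F) {C : ℝ} {S : 𝓓E →L[ℝ] ℝ}
    (hS : SupBounded C S) (ρ : E → ℝ) (hρ : ContDiff ℝ (⊤ : ℕ∞) ρ) (hs : HasCompactSupport ρ)
    (heven : ∀ x, ρ (-x) = ρ x) (ω : 𝓓E) :
    ∫ z, ρ z * S (translate z ω) ∂μ =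
      ∑ i, ∫ y, b.coord i (ω y) * S (translate (-y) (bumpVector ρ hρ hs (b i))) ∂μ := by
  have : CompleteSpace F := FiniteDimensional.complete ℝ F
  obtain ⟨G, hG⟩ := hS.exists_extension
  let Φ : 𝓓E →L[ℝ] (E →ᵇ F) := TestFunction.toBoundedContinuousFunctionCLM ℝ
  have hΦ : ∀ (f : 𝓓E) x, Φ f x = f x := fun _ _ => rfl
  have hcoord : ∀ i, Continuous (b.coord i) := fun i =>
    LinearMap.continuous_of_finiteDimensional _
  have hi1 : Integrable (fun z => ρ z • Φ (translate z ω)) μ :=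
    (hρ.continuous.smul (continuous_toBCF_translate ω)).integrable_of_hasCompactSupport
      (hs.smul_right)
  have hi2 : ∀ i, Integrable (fun y => b.coord i (ω y) •
      Φ (translate (-y) (bumpVector ρ hρ hs (b i)))) μ := fun i =>
    (((hcoord i).comp ω.continuous).smul
      ((continuous_toBCF_translate _).comp continuous_neg)).integrable_of_hasCompactSupport
      ((ω.hasCompactSupport.comp_left (map_zero (b.coord i))).smul_right)
  have key : ∫ z, ρ z • Φ (translate z ω) ∂μ =
      ∑ i, ∫ y, b.coord i (ω y) • Φ (translate (-y) (bumpVector ρ hρ hs (b i))) ∂μ := by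
    ext x
    let ev := BoundedContinuousFunction.evalCLM ℝ x (β := F)
    have e1 := ev.integral_comp_comm hi1
    have e2 := fun i => ev.integral_comp_comm (hi2 i)
    change ev _ = ev _
    rw [map_sum, ← e1]
    simp only [← e2]
    rw [← integral_finsetSum _ fun i _ => ev.integrable_comp (hi2 i)]
    -- Substituting z = y - x moves the translation from ω onto ρ; evenness then turns ρ(y - x) into
    -- ρ(x - y).
    rw [← integral_add_left_eq_self (μ := μ) _ (-x)]
    refine integral_congr_ae (ae_of_all _ fun y => ?_)
    simp only [ev, map_smul, BoundedContinuousFunction.evalCLM_apply, hΦ, translate_apply]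
    have h1 : x + (-x + y) = y := by abel
    rw [h1]
    conv_lhs => rw [← b.sum_repr (ω y), Finset.smul_sum]
    refine Finset.sum_congr rfl fun i _ => ?_
    change ρ (-x + y) • _ = _ • (ρ (x + -y) • b i)
    rw [← heven (x + -y), smul_comm]
    simp [add_comm]
  have key2 := congrArg G key
  rw [map_sum, ← G.integral_comp_comm hi1] at key2
  simp only [← G.integral_comp_comm (hi2 _), map_smul, smul_eq_mul] at key2
  simpa only [Φ, hG] using key2

/-- A functional annihilates the test functions supported away from its support. -/
theorem apply_eq_zero_of_disjoint_dsupport [FiniteDimensional ℝ E] (S : 𝓓E →L[ℝ] ℝ) (ω : 𝓓E)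
    (h : Disjoint (tsupport ω) (Distribution.dsupport (S : 𝓓E → ℝ))) : S ω = 0 := by
  have hcov : ∀ x ∈ tsupport ω, ∃ s : Set E,
      Distribution.IsVanishingOn (S : 𝓓E → ℝ) s ∧ IsOpen s ∧ x ∈ s := fun x hx =>
    (Distribution.notMem_dsupport_iff x).1 fun hx' => Set.disjoint_left.1 h hx hx'
  choose! U hU hUo hxU using hcov
  obtain ⟨t, ht⟩ := ω.hasCompactSupport.isCompact.elim_finite_subcover
    (fun x : tsupport ω => U x) (fun x => hUo x x.2)
    (fun x hx => Set.mem_iUnion.2 ⟨⟨x, hx⟩, hxU x hx⟩)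
  obtain ⟨f, hf⟩ := SmoothPartitionOfUnity.exists_isSubordinate (modelWithCornersSelf ℝ E)
    (isClosed_tsupport ω) (fun x : t => U x.1) (fun x => hUo _ x.1.2) (by
      intro x hx
      obtain ⟨i, hi, hxi⟩ := Set.mem_iUnion₂.1 (ht hx)
      exact Set.mem_iUnion.2 ⟨⟨i, hi⟩, hxi⟩)
  have hsm : ∀ i, ContDiff ℝ (⊤ : ℕ∞) (f i) := fun i => (f i).contMDiff.contDiff
  -- A finite partition of unity cuts ω into pieces, each supported in an open set on which S
  -- vanishes.
  have hsum : ω = ∑ i, smoothSMul (f i) (hsm i) ω := by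
    ext1 x
    have : (∑ i, smoothSMul (f i) (hsm i) ω) x = ∑ i, f i x • ω x := by
      have h := map_sum (TestFunction.toBoundedContinuousFunctionCLM ℝ)
        (fun i => smoothSMul (f i) (hsm i) ω) Finset.univ
      have h' := DFunLike.congr_fun h x
      rw [BoundedContinuousFunction.sum_apply] at h'
      exact h'
    rw [this, ← Finset.sum_smul]
    by_cases hx : x ∈ tsupport ω
    · have h1 := f.sum_eq_one hx
      rw [finsum_eq_sum_of_fintype] at h1
      rw [h1, one_smul]
    · rw [image_eq_zero_of_notMem_tsupport hx, smul_zero]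
  rw [hsum, map_sum]
  refine Finset.sum_eq_zero fun i _ => hU i.1.1 i.1.2 _ ?_
  exact (tsupport_smul_subset_left (f i) ω).trans (hf i)

end TestFunction

end GMT

/-! ### Equivalence of the comass and the operator norm. -/

namespace GMT

open scoped Pointwise

instance finiteDimensional_covector (d k : ℕ) : FiniteDimensional ℝ (Covector d k) :=
  Module.Finite.of_injective
    (ContinuousMultilinearMap.toMultilinearMapLinear.comp
      (ContinuousAlternatingMap.toContinuousMultilinearMapLinear (R := ℝ) (A := ℝ) (M := Rd d)
        (N := ℝ) (ι := Fin k)) : Covector d k →ₗ[ℝ] MultilinearMap ℝ (fun _ : Fin k => Rd d) ℝ)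
    (ContinuousMultilinearMap.toMultilinearMap_injective.comp
      ContinuousAlternatingMap.toContinuousMultilinearMap_injective)

theorem pairing_le_comass {d k : ℕ} (w : Covector d k) {ξ : ⋀[ℝ]^k (Rd d)} (h : IsSimple ξ) :
    pairing w ξ ≤ comass w * ‖ξ‖ := by
  by_cases h0 : ξ = 0
  · simp [h0, pairing]
  have hp : 0 < ‖ξ‖ := norm_pos_iff.2 h0
  have h1 : pairing w (‖ξ‖⁻¹ • ξ) ≤ comass w := by
    refine le_csSup (bddAbove_comass w) ⟨_, ?_, ?_, rfl⟩
    · obtain ⟨a, v, rfl⟩ := h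
      exact ⟨_ * a, v, smul_smul _ _ _⟩
    · rw [norm_smul, norm_inv, norm_norm, inv_mul_cancel₀ hp.ne']
  have h2 : pairing w (‖ξ‖⁻¹ • ξ) = ‖ξ‖⁻¹ * pairing w ξ := by simp [pairing]
  rw [h2, inv_mul_le_iff₀ hp] at h1
  linarith

theorem IsSimple.neg {d k : ℕ} {ξ : ⋀[ℝ]^k (Rd d)} (h : IsSimple ξ) : IsSimple (-ξ) := by
  obtain ⟨a, v, rfl⟩ := h
  exact ⟨-a, v, (neg_smul _ _).symm⟩

theorem abs_pairing_le_comass {d k : ℕ} (w : Covector d k) {ξ : ⋀[ℝ]^k (Rd d)}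
    (h : IsSimple ξ) : |pairing w ξ| ≤ comass w * ‖ξ‖ := by
  refine abs_le'.2 ⟨pairing_le_comass w h, ?_⟩
  have := pairing_le_comass w h.neg
  rwa [norm_neg, pairing, map_neg] at this

theorem comass_nonneg {d k : ℕ} (w : Covector d k) : 0 ≤ comass w := by
  by_cases h : ∃ ξ : ⋀[ℝ]^k (Rd d), IsSimple ξ ∧ ‖ξ‖ = 1
  · obtain ⟨ξ, h1, h2⟩ := h
    have := abs_pairing_le_comass w h1
    rw [h2, mul_one] at this
    exact (abs_nonneg _).trans this
  · refine Real.sSup_nonneg ?_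
    rintro r ⟨ξ, h1, h2, -⟩
    exact absurd ⟨ξ, h1, h2⟩ h

theorem comass_smul {d k : ℕ} {a : ℝ} (ha : 0 ≤ a) (w : Covector d k) :
    comass (a • w) = a * comass w := by
  have : {r : ℝ | ∃ ξ : ⋀[ℝ]^k (Rd d), IsSimple ξ ∧ ‖ξ‖ = 1 ∧ r = pairing (a • w) ξ} =
      a • {r : ℝ | ∃ ξ : ⋀[ℝ]^k (Rd d), IsSimple ξ ∧ ‖ξ‖ = 1 ∧ r = pairing w ξ} := by
    have hp : ∀ ξ, pairing (a • w) ξ = a * pairing w ξ := fun ξ => by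
      have : (a • w).toAlternatingMap = a • w.toAlternatingMap := rfl
      simp [pairing, this]
    ext r
    simp only [hp, Set.mem_smul_set, Set.mem_ofPred_eq, smul_eq_mul]
    constructor
    · rintro ⟨ξ, h1, h2, rfl⟩
      exact ⟨_, ⟨ξ, h1, h2, rfl⟩, rfl⟩
    · rintro ⟨_, ⟨ξ, h1, h2, rfl⟩, rfl⟩
      exact ⟨ξ, h1, h2, rfl⟩
  rw [comass, this, Real.sSup_smul_of_nonneg ha, comass, smul_eq_mul]

theorem exists_bound_dual_of_finiteDimensional {V : Type*} [NormedAddCommGroup V]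
    [NormedSpace ℝ V] [FiniteDimensional ℝ V] (f : V →ₗ[ℝ] ℝ) :
    ∃ K : ℝ, 0 ≤ K ∧ ∀ v, |f v| ≤ K * ‖v‖ :=
  ⟨‖LinearMap.toContinuousLinearMap f‖, norm_nonneg _,
    (LinearMap.toContinuousLinearMap f).le_opNorm⟩

/-- The comass is bounded by a multiple of the operator norm. -/
theorem exists_comass_le_norm (d k : ℕ) :
    ∃ A : ℝ, 0 < A ∧ ∀ w : Covector d k, comass w ≤ A * ‖w‖ := by
  let b := Module.finBasis ℝ (Covector d k)
  choose K hK0 hK using fun i => exists_bound_dual_of_finiteDimensional (b.coord i)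
  have hpos : 0 ≤ ∑ i, K i * comass (b i) :=
    Finset.sum_nonneg fun i _ => mul_nonneg (hK0 i) (comass_nonneg _)
  refine ⟨∑ i, K i * comass (b i) + 1, by linarith, fun w => ?_⟩
  refine Real.sSup_le ?_ (mul_nonneg (by linarith) (norm_nonneg w))
  rintro r ⟨ξ, hξ, h1, rfl⟩
  let ev : Covector d k →ₗ[ℝ] ℝ :=
    { toFun := fun w => pairing w ξ
      map_add' := fun v w => by
        have : (v + w).toAlternatingMap = v.toAlternatingMap + w.toAlternatingMap := rfl
        simp [pairing, this]
      map_smul' := fun a w => by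
        have : (a • w).toAlternatingMap = a • w.toAlternatingMap := rfl
        simp [pairing, this] }
  have h2 : pairing w ξ = ∑ i, b.coord i w * pairing (b i) ξ := by
    change ev w = ∑ i, b.coord i w * ev (b i)
    conv_lhs => rw [← b.sum_repr w, map_sum]
    simp
  rw [h2]
  calc ∑ i, b.coord i w * pairing (b i) ξ ≤ ∑ i, K i * comass (b i) * ‖w‖ := by
        refine Finset.sum_le_sum fun i _ => ?_
        refine (le_abs_self _).trans ?_
        rw [abs_mul, mul_right_comm]
        refine mul_le_mul (hK i w) ?_ (abs_nonneg _) (mul_nonneg (hK0 i) (norm_nonneg w))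
        simpa [h1] using abs_pairing_le_comass (b i) hξ
    _ ≤ _ := by
        rw [← Finset.sum_mul]
        nlinarith [norm_nonneg w]

/-- The squared norm is a Gram determinant; Cauchy–Schwarz bounds each of its k! terms by (∏ ‖v
i‖)². The resulting constant is not sharp, but any constant suffices. -/
theorem norm_ιMulti_le {d k : ℕ} (v : Fin k → Rd d) :
    ‖exteriorPower.ιMulti ℝ k v‖ ≤ k.factorial * ∏ i, ‖v i‖ := by
  have hP : 0 ≤ ∏ i, ‖v i‖ := Finset.prod_nonneg fun i _ => norm_nonneg _
  have h1 : ‖exteriorPower.ιMulti ℝ k v‖ ^ 2 ≤ k.factorial * (∏ i, ‖v i‖) ^ 2 := by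
    rw [← real_inner_self_eq_norm_sq, exteriorPower.inner_ιMulti_ιMulti, Matrix.det_apply]
    have h2 : ∀ σ ∈ (Finset.univ : Finset (Equiv.Perm (Fin k))),
        Equiv.Perm.sign σ • ∏ i, (Matrix.of fun i j => inner ℝ (v j) (v i)) (σ i) i ≤
          (∏ i, ‖v i‖) ^ 2 := by
      intro σ _
      refine (le_abs_self _).trans ?_
      rw [Units.smul_def, zsmul_eq_mul, abs_mul, ← Int.cast_abs,
        Int.isUnit_iff_abs_eq.1 (Units.isUnit _), Int.cast_one, one_mul, Finset.abs_prod]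
      calc ∏ i, |(Matrix.of fun i j => inner ℝ (v j) (v i)) (σ i) i|
          ≤ ∏ i, (‖v i‖ * ‖v (σ i)‖) :=
            Finset.prod_le_prod (fun _ _ => abs_nonneg _) fun i _ =>
              abs_real_inner_le_norm (v i) (v (σ i))
        _ = (∏ i, ‖v i‖) ^ 2 := by
            rw [Finset.prod_mul_distrib, Equiv.prod_comp σ fun i => ‖v i‖, sq]
    refine (Finset.sum_le_card_nsmul _ _ _ h2).trans (le_of_eq ?_)
    simp [Fintype.card_perm]
  have h3 : (1 : ℝ) ≤ k.factorial := by exact_mod_cast Nat.one_le_iff_ne_zero.2 k.factorial_ne_zero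
  refine le_of_sq_le_sq ?_ (by positivity)
  nlinarith [mul_nonneg (sq_nonneg (∏ i, ‖v i‖))
    (mul_nonneg (by linarith : (0 : ℝ) ≤ k.factorial) (sub_nonneg.2 h3))]

/-- The operator norm is bounded by a multiple of the comass. -/
theorem norm_le_comass {d k : ℕ} (w : Covector d k) : ‖w‖ ≤ k.factorial * comass w := by
  refine ContinuousAlternatingMap.opNorm_le_bound _
    (mul_nonneg (Nat.cast_nonneg _) (comass_nonneg w)) fun v => ?_
  have h1 := abs_pairing_le_comass w (ξ := exteriorPower.ιMulti ℝ k v) ⟨1, v, (one_smul _ _).symm⟩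
  have h2 : pairing w (exteriorPower.ιMulti ℝ k v) = w v := by simp [pairing]
  rw [h2] at h1
  calc ‖w v‖ ≤ comass w * ‖exteriorPower.ιMulti ℝ k v‖ := h1
    _ ≤ comass w * (k.factorial * ∏ i, ‖v i‖) :=
      mul_le_mul_of_nonneg_left (norm_ιMulti_le v) (comass_nonneg w)
    _ = _ := by ring

end GMT

/-! ### Cartan's formula and translation estimates for normal currents. -/

namespace GMT

open MeasureTheory

/-- Contraction of a form with a fixed vector. -/
def contract {d k : ℕ} (z : Rd d) : Form d (k + 1) →L[ℝ] Form d k :=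
  TestFunction.postcompCLM ((ContinuousLinearMap.apply ℝ (Covector d k) z).comp
    (ContinuousAlternatingMap.curryLeftLI (𝕜 := ℝ) (E := Rd d) (F := ℝ)
      (n := k)).toContinuousLinearMap)

@[simp]
theorem contract_apply {d k : ℕ} (z : Rd d) (ω : Form d (k + 1)) (x : Rd d) :
    contract z ω x = (ω x).curryLeft z := rfl

theorem norm_contract_apply_le {d k : ℕ} (z : Rd d) (ω : Form d (k + 1)) (x : Rd d) :
    ‖contract z ω x‖ ≤ ‖ω x‖ * ‖z‖ := by
  rw [contract_apply, ← ContinuousAlternatingMap.norm_curryLeft (ω x)]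
  exact ((ω x).curryLeft).le_opNorm z

theorem form_differentiable {d k : ℕ} (ω : Form d k) : Differentiable ℝ ω :=
  ω.contDiff.differentiable (by simp)

theorem lineDerivCLM_form_apply {d k : ℕ} (z : Rd d) (ω : Form d k) (x : Rd d) :
    (TestFunction.lineDerivCLM ℝ z ω : Form d k) x = fderiv ℝ ω x z := by
  simp [(form_differentiable ω x).lineDeriv_eq_fderiv]

theorem fderiv_contract_apply {d k : ℕ} (z : Rd d) (ω : Form d (k + 1)) (x u : Rd d) :
    fderiv ℝ (contract z ω) x u = (fderiv ℝ ω x u).curryLeft z := by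
  let P : Covector d (k + 1) →L[ℝ] Covector d k :=
    (ContinuousLinearMap.apply ℝ (Covector d k) z).comp
    (ContinuousAlternatingMap.curryLeftLI (𝕜 := ℝ) (E := Rd d) (F := ℝ)
      (n := k)).toContinuousLinearMap
  have h := (P.hasFDerivAt.comp x (form_differentiable ω x).hasFDerivAt).fderiv
  have h2 : (contract z ω : Rd d → Covector d k) = P ∘ ω := rfl
  rw [h2, h]
  rfl

/-- Cartan's formula for `0`-forms and a constant vector field. -/
theorem lineDeriv_eq_contract_extD {d : ℕ} (z : Rd d) (ω : Form d 0) :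
    (TestFunction.lineDerivCLM ℝ z ω : Form d 0) = contract z (extD d 0 ω) := by
  ext x v
  rw [lineDerivCLM_form_apply, contract_apply, extD_apply,
    ContinuousAlternatingMap.curryLeft_apply_apply, extDeriv,
    ContinuousAlternatingMap.alternatizeUncurryFin_apply]
  simp [Subsingleton.elim _ v]

/-- Cartan's formula for forms of positive degree and a constant vector field. -/
theorem lineDeriv_eq_extD_contract_add {d k : ℕ} (z : Rd d) (ω : Form d (k + 1)) :
    (TestFunction.lineDerivCLM ℝ z ω : Form d (k + 1)) =
      extD d k (contract z ω) + contract z (extD d (k + 1) ω) := by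
  ext x v
  have hadd : (extD d k (contract z ω) + contract z (extD d (k + 1) ω)) x =
    extD d k (contract z ω) x + contract z (extD d (k + 1) ω) x := rfl
  -- The index 0 term of ι_z dω is the derivative along z; the others cancel against d(ι_z ω), their
  -- signs being shifted by one.
  rw [lineDerivCLM_form_apply, hadd, ContinuousAlternatingMap.add_apply, contract_apply,
    extD_apply, extD_apply, ContinuousAlternatingMap.curryLeft_apply_apply, extDeriv, extDeriv,
    ContinuousAlternatingMap.alternatizeUncurryFin_apply,
    ContinuousAlternatingMap.alternatizeUncurryFin_apply, Fin.sum_univ_succ (n := k + 1)]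
  have h0 : (0 : Fin (k + 2)).removeNth (Matrix.vecCons z v) = v := by
    ext i; simp [Fin.removeNth]
  have hs : ∀ i : Fin (k + 1), i.succ.removeNth (Matrix.vecCons z v) =
      Matrix.vecCons z (i.removeNth v) := by
    intro i
    ext j
    refine Fin.cases ?_ (fun j => ?_) j <;> simp [Fin.removeNth]
  simp only [hs, h0, fderiv_contract_apply, ContinuousAlternatingMap.curryLeft_apply_apply,
    Matrix.cons_val_zero, Matrix.cons_val_succ, Fin.val_succ, pow_succ]
  simp

theorem extD_translate {d k : ℕ} (z : Rd d) (ω : Form d k) :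
    extD d k (translate z ω) = translate z (extD d k ω) := by
  ext1 x
  rw [translate_apply, extD_apply, extD_apply, extDeriv, extDeriv]
  congr 1
  exact fderiv_comp_add_right (f := ω) z

theorem lineDerivCLM_translate {d k : ℕ} (y z : Rd d) (ω : Form d k) :
    (TestFunction.lineDerivCLM ℝ z (translate y ω) : Form d k) =
      translate y (TestFunction.lineDerivCLM ℝ z ω : Form d k) := by
  ext1 x
  rw [translate_apply, lineDerivCLM_form_apply, lineDerivCLM_form_apply]
  congr 1
  exact fderiv_comp_add_right (f := ω) y

/-- The boundary of a current is bounded for the supremum norm by `C`. -/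
def BoundarySupBounded {d : ℕ} (C : ℝ) : {k : ℕ} → Current d k → Prop
  | 0, _ => True
  | _ + 1, T => SupBounded C (boundary T)

theorem SupBounded.abs_lineDeriv_le {d k : ℕ} {C : ℝ} (hC : 0 ≤ C) {S : Current d k}
    (hS : SupBounded C S) (hB : BoundarySupBounded C S) (ω : Form d k) (z : Rd d) {M : ℝ}
    (hM : 0 ≤ M) (h1 : ∀ x, ‖ω x‖ ≤ M) (h2 : ∀ x, ‖extD d k ω x‖ ≤ M) :
    |S (TestFunction.lineDerivCLM ℝ z ω : Form d k)| ≤ 2 * C * (M * ‖z‖) := by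
  have hMz : 0 ≤ M * ‖z‖ := mul_nonneg hM (norm_nonneg z)
  have h3 : |S (contract z (extD d k ω))| ≤ C * (M * ‖z‖) := hS _ _ hMz fun x =>
    (norm_contract_apply_le _ _ _).trans (mul_le_mul_of_nonneg_right (h2 x) (norm_nonneg z))
  cases k with
  | zero =>
    rw [lineDeriv_eq_contract_extD]
    nlinarith [mul_nonneg hC hMz]
  | succ k =>
    rw [lineDeriv_eq_extD_contract_add, map_add]
    have h4 : |S (extD d k (contract z ω))| ≤ C * (M * ‖z‖) := hB _ _ hMz fun x =>
      (norm_contract_apply_le _ _ _).trans (mul_le_mul_of_nonneg_right (h1 x) (norm_nonneg z))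
    linarith [abs_add_le (S (extD d k (contract z ω))) (S (contract z (extD d (k + 1) ω)))]

/-- A normal current changes little when its argument is translated. -/
theorem SupBounded.abs_translate_sub_le_of_norm_le {d k : ℕ} {C : ℝ} (hC : 0 ≤ C)
    {S : Current d k} (hS : SupBounded C S) (hB : BoundarySupBounded C S) (ω : Form d k)
    (z : Rd d) {M : ℝ} (hM : 0 ≤ M) (h1 : ∀ x, ‖ω x‖ ≤ M) (h2 : ∀ x, ‖extD d k ω x‖ ≤ M) :
    |S (translate z ω) - S ω| ≤ 2 * C * (M * ‖z‖) := by
  refine hS.abs_translate_sub_le ω z fun t => ?_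
  rw [← lineDerivCLM_translate]
  refine hS.abs_lineDeriv_le hC hB _ z hM (fun x => h1 _) fun x => ?_
  rw [extD_translate]
  exact h2 _

/-! ### From mass bounds to sup-norm bounds, and their passage to weak* limits. -/

theorem supBounded_of_mass_le {d k : ℕ} {T : Current d k} {c A : ℝ} (hc : 0 ≤ c) (hA : 0 < A)
    (hcomass : ∀ w : Covector d k, comass w ≤ A * ‖w‖) (h : mass T ≤ ENNReal.ofReal c) :
    SupBounded (c * A) T := by
  have key : ∀ (ω : Form d k) (M : ℝ), 0 < M → (∀ x, ‖ω x‖ ≤ M) → T ω ≤ c * A * M := by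
    intro ω M hM hω
    have hAM : 0 < A * M := mul_pos hA hM
    have h1 : ENNReal.ofReal (T ((A * M)⁻¹ • ω)) ≤ mass T := by
      refine le_iSup₂_of_le ((A * M)⁻¹ • ω) (fun x => ?_) le_rfl
      change comass ((A * M)⁻¹ • ω x) ≤ 1
      rw [comass_smul (inv_nonneg.2 hAM.le), inv_mul_le_iff₀ hAM, mul_one]
      exact (hcomass _).trans (mul_le_mul_of_nonneg_left (hω x) hA.le)
    have h2 := (ENNReal.ofReal_le_ofReal_iff hc).1 (h1.trans h)
    rw [map_smul, smul_eq_mul, inv_mul_le_iff₀ hAM] at h2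
    linarith
  intro ω M hM hω
  rcases hM.eq_or_lt with rfl | hM
  · have : ω = 0 := by
      ext1 x
      exact norm_le_zero_iff.1 (hω x)
    simp [this]
  · refine abs_le'.2 ⟨key ω M hM hω, ?_⟩
    rw [← map_neg]
    refine key (-ω) M hM fun x => ?_
    change ‖-(ω x)‖ ≤ M
    rw [norm_neg]
    exact hω x

/-- Lower semicontinuity: the limit current, not assumed normal, inherits the bound of the sequence.
-/
theorem SupBounded.of_tendsto {d k : ℕ} {Tseq : ℕ → Current d k} {T : Current d k} {C : ℝ}
    (h : ∀ j, SupBounded C (Tseq j)) (hT : WeakStarTendsto Tseq T) : SupBounded C T :=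
  fun ω M hM hω => le_of_tendsto (hT ω).abs (Eventually.of_forall fun j => h j ω M hM hω)

theorem SupBounded.sub {d k : ℕ} {S T : Current d k} {C : ℝ} (hS : SupBounded C S)
    (hT : SupBounded C T) : SupBounded (2 * C) (S - T) := by
  intro ω M hM hω
  change |S ω - T ω| ≤ _
  linarith [abs_sub (S ω) (T ω), hS ω M hM hω, hT ω M hM hω]

theorem BoundarySupBounded.of_tendsto {d k : ℕ} {Tseq : ℕ → Current d k} {T : Current d k}
    {C : ℝ} (h : ∀ j, BoundarySupBounded C (Tseq j)) (hT : WeakStarTendsto Tseq T) :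
    BoundarySupBounded C T := by
  cases k with
  | zero => trivial
  | succ k => exact SupBounded.of_tendsto (Tseq := fun j => boundary (Tseq j)) h fun ω => hT _

theorem BoundarySupBounded.sub {d k : ℕ} {S T : Current d k} {C : ℝ}
    (hS : BoundarySupBounded C S) (hT : BoundarySupBounded C T) :
    BoundarySupBounded (2 * C) (S - T) := by
  cases k with
  | zero => trivial
  | succ k => exact SupBounded.sub (S := boundary S) (T := boundary T) hS hT

theorem exists_supBounded (d k : ℕ) {c : ℝ} (hc : 0 < c) :
    ∃ C : ℝ, 0 < C ∧ ∀ T : Current d k, mass T + boundaryMass T < ENNReal.ofReal c →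
      SupBounded C T ∧ BoundarySupBounded C T := by
  have hmono : ∀ {k : ℕ} {C C' : ℝ} {T : Current d k}, C ≤ C' → SupBounded C T →
      SupBounded C' T := fun h hT ω M hM hω =>
    (hT ω M hM hω).trans (mul_le_mul_of_nonneg_right h hM)
  obtain ⟨A, hA, hA'⟩ := exists_comass_le_norm d k
  cases k with
  | zero =>
    exact ⟨c * A, mul_pos hc hA, fun T hT =>
      ⟨supBounded_of_mass_le hc.le hA hA' (le_self_add.trans hT.le), trivial⟩⟩
  | succ k =>
    obtain ⟨B, hB, hB'⟩ := exists_comass_le_norm d k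
    refine ⟨c * A + c * B, by positivity, fun T hT => ⟨?_, ?_⟩⟩
    · exact hmono (by nlinarith) (supBounded_of_mass_le hc.le hA hA' (le_self_add.trans hT.le))
    · exact hmono (T := boundary T) (by nlinarith)
        (supBounded_of_mass_le hc.le hB hB' (le_add_self.trans hT.le))

/-! ### Mollification estimate and flat convergence of weak* null sequences. -/

/-- A functional bounded in the supremum norm is controlled by its oscillation under small
translations and by its values on translated bumps. -/
theorem SupBounded.abs_le_of_translate {d k : ℕ} {ι : Type*} [Fintype ι]
    (b : Module.Basis ι ℝ (Covector d k)) {C : ℝ} {S : Current d k} (hS : SupBounded C S)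
    (ρ : ContDiffBump (0 : Rd d)) {K : ι → ℝ}
    (hK0 : ∀ i, 0 ≤ K i) (hK : ∀ i w, |b.coord i w| ≤ K i * ‖w‖)
    (hI : ∀ i, Integrable fun y => S (translate (-y)
      (bumpVector (ρ.normed volume) ρ.contDiff_normed ρ.hasCompactSupport_normed (b i))))
    (ω : Form d k) {A M : ℝ} (hω : ∀ x, ‖ω x‖ ≤ M)
    (hA : ∀ z, ‖z‖ ≤ ρ.rOut → |S (translate z ω) - S ω| ≤ A) :
    |S ω| ≤ A + ∑ i, K i * M * ∫ y, |S (translate (-y)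
      (bumpVector (ρ.normed volume) ρ.contDiff_normed ρ.hasCompactSupport_normed (b i)))| := by
  have hηint : Integrable (ρ.normed (volume : Measure (Rd d))) volume := ρ.integrable_normed
  have hcont : Continuous fun z => S (translate z ω) := hS.continuous_translate ω
  have hint : Integrable fun z => ρ.normed volume z * S (translate z ω) :=
    (ρ.continuous_normed.mul hcont).integrable_of_hasCompactSupport
      ρ.hasCompactSupport_normed.mul_right
  have hsplit : S ω = (∫ z, ρ.normed volume z * (S ω - S (translate z ω))) +
      ∫ z, ρ.normed volume z * S (translate z ω) := by
    have h1 : ∫ z, ρ.normed volume z * S ω = S ω := by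
      rw [integral_mul_const, ρ.integral_normed, one_mul]
    rw [← integral_add _ hint]
    · simp only [← mul_add, sub_add_cancel, h1]
    · simp only [mul_sub]
      exact (hηint.mul_const _).sub hint
  have hfirst : |∫ z, ρ.normed volume z * (S ω - S (translate z ω))| ≤ A := by
    have h1 : ∫ z, ρ.normed volume z * A = A := by
      rw [integral_mul_const, ρ.integral_normed, one_mul]
    rw [← h1, ← Real.norm_eq_abs]
    refine norm_integral_le_of_norm_le (hηint.mul_const A) (ae_of_all volume fun z => ?_)
    rw [Real.norm_eq_abs, abs_mul, abs_of_nonneg (ρ.nonneg_normed z), abs_sub_comm]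
    by_cases hz : ‖z‖ ≤ ρ.rOut
    · exact mul_le_mul_of_nonneg_left (hA z hz) (ρ.nonneg_normed z)
    · have : ρ.normed volume z = 0 := by
        rw [← Function.notMem_support, ρ.support_normed_eq, mem_ball_zero_iff]
        exact fun h => hz h.le
      simp [this]
  have hsecond : |∫ z, ρ.normed volume z * S (translate z ω)| ≤ ∑ i, K i * M * ∫ y, |S (translate (-y)
      (bumpVector (ρ.normed volume) ρ.contDiff_normed ρ.hasCompactSupport_normed (b i)))| := by
    rw [hS.integral_translate_eq b (ρ.normed volume) ρ.contDiff_normed ρ.hasCompactSupport_normed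
      (fun x => ρ.normed_neg x) ω]
    refine (Finset.abs_sum_le_sum_abs _ _).trans (Finset.sum_le_sum fun i _ => ?_)
    rw [← integral_const_mul, ← Real.norm_eq_abs]
    refine norm_integral_le_of_norm_le ((hI i).abs.const_mul _) (ae_of_all _ fun y => ?_)
    rw [Real.norm_eq_abs, abs_mul]
    exact mul_le_mul_of_nonneg_right
      ((hK i _).trans (mul_le_mul_of_nonneg_left (hω y) (hK0 i))) (abs_nonneg _)
  exact (congrArg abs hsplit).le.trans ((abs_add_le _ _).trans (add_le_add hfirst hsecond))

theorem tsupport_translate_subset {d k : ℕ} (y : Rd d) (f : Form d k) {r : ℝ}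
    (hf : tsupport f ⊆ Metric.closedBall 0 r) :
    tsupport (translate (-y) f) ⊆ Metric.closedBall y r := by
  refine closure_minimal (fun x hx => ?_) Metric.isClosed_closedBall
  have := hf (subset_tsupport f (show x + -y ∈ Function.support f from hx))
  rw [mem_closedBall_zero_iff] at this
  rwa [Metric.mem_closedBall, dist_eq_norm, sub_eq_add_neg]

/-- The `L¹` norms of the translation orbits of a test form under uniformly bounded currents
supported in a fixed compact set tend to zero if the currents do so weakly*. -/
theorem tendsto_integral_abs_translate {d k : ℕ} {X : Set (Rd d)} (hX : IsCompact X) {C : ℝ}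
    {S : ℕ → Current d k} (hS : ∀ j, SupBounded C (S j))
    (hX0 : ∀ j (ω : Form d k), Disjoint (tsupport ω) X → S j ω = 0)
    (hlim : WeakStarTendsto S 0) (f : Form d k) :
    (∀ j, Integrable fun y => S j (translate (-y) f)) ∧
      Tendsto (fun j => ∫ y, |S j (translate (-y) f)|) atTop (𝓝 0) := by
  obtain ⟨r, hr⟩ := f.hasCompactSupport.isCompact.isBounded.subset_closedBall (0 : Rd d)
  have hK : IsCompact (Metric.cthickening r X) := hX.cthickening
  have hzero : ∀ j y, y ∉ Metric.cthickening r X → S j (translate (-y) f) = 0 := by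
    intro j y hy
    refine hX0 j _ (Set.disjoint_left.2 fun x hx hxX => hy ?_)
    have := tsupport_translate_subset y f hr hx
    rw [Metric.mem_closedBall, dist_comm] at this
    exact Metric.mem_cthickening_of_dist_le y x r X hxX this
  have hcont : ∀ j, Continuous fun y => S j (translate (-y) f) := fun j =>
    ((hS j).continuous_translate f).comp continuous_neg
  have hint : ∀ j, Integrable fun y => S j (translate (-y) f) := fun j =>
    (hcont j).integrable_of_hasCompactSupport (HasCompactSupport.intro hK fun y => hzero j y)
  refine ⟨hint, ?_⟩
  obtain ⟨M, hM⟩ := f.continuous.bounded_above_of_compact_support f.hasCompactSupport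
  have hM0 : 0 ≤ M := (norm_nonneg _).trans (hM 0)
  -- The dominating function is C * M on the thickening of X by the radius of the support of f, and
  -- 0 elsewhere.
  have h := tendsto_integral_of_dominated_convergence (μ := volume)
    (F := fun j y => |S j (translate (-y) f)|) (f := fun _ => 0)
    ((Metric.cthickening r X).indicator fun _ => C * M)
    (fun j => (hcont j).abs.aestronglyMeasurable)
    ((integrable_indicator_iff hK.measurableSet).2
      (continuousOn_const.integrableOn_compact hK))
    (fun j => ae_of_all _ fun y => by
      rw [Real.norm_eq_abs, abs_abs]
      by_cases hy : y ∈ Metric.cthickening r X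
      · rw [Set.indicator_of_mem hy]
        exact hS j _ M hM0 fun x => hM _
      · rw [Set.indicator_of_notMem hy, hzero j y hy, abs_zero])
    (ae_of_all _ fun y => by simpa using (hlim (translate (-y) f)).abs)
  simpa using h

/-- Weak* null sequences of uniformly normal currents with supports in a fixed compact set
are null for the flat norm. -/
theorem tendsto_flatNorm_of_weakStarTendsto_zero {d k : ℕ} {X : Set (Rd d)} (hX : IsCompact X)
    {C : ℝ} (hC : 0 ≤ C) {l : ℝ} (hl : 0 ≤ l) {S : ℕ → Current d k}
    (hS : ∀ j, SupBounded C (S j)) (hB : ∀ j, BoundarySupBounded C (S j))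
    (hX0 : ∀ j (ω : Form d k), Disjoint (tsupport ω) X → S j ω = 0)
    (hlim : WeakStarTendsto S 0) :
    Tendsto (fun j => flatNorm l (S j)) atTop (𝓝 0) := by
  rw [ENNReal.tendsto_nhds_zero]
  intro ε hε
  by_cases hεt : ε = ∞
  · simp [hεt]
  set δ := ε.toReal with hδ
  have hδ0 : 0 < δ := ENNReal.toReal_pos hε.ne' hεt
  -- One bound for the operator norms of both ω and dω, valid for every admissible ω.
  set M : ℝ := k.factorial * l + (k + 1).factorial with hMdef
  have hM : 0 ≤ M := by positivity
  have hCM : 0 ≤ C * M := mul_nonneg hC hM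
  -- Makes the translation error 2 * C * M * r at most δ / 2; the + 1 covers C * M = 0.
  set r := δ / (4 * (C * M + 1)) with hrdef
  have hr : 0 < r := by positivity
  let ρ : ContDiffBump (0 : Rd d) := ⟨r / 2, r, half_pos hr, half_lt_self hr⟩
  let b := Module.finBasis ℝ (Covector d k)
  choose K hK0 hK using fun i => exists_bound_dual_of_finiteDimensional (b.coord i)
  have hI := fun i => tendsto_integral_abs_translate hX hS hX0 hlim
    (bumpVector (ρ.normed volume) ρ.contDiff_normed ρ.hasCompactSupport_normed (b i))
  have hsum : Tendsto (fun j => ∑ i, K i * M * ∫ y, |S j (translate (-y)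
      (bumpVector (ρ.normed volume) ρ.contDiff_normed ρ.hasCompactSupport_normed (b i)))|)
      atTop (𝓝 0) := by
    have := tendsto_finsetSum Finset.univ fun i _ => (hI i).2.const_mul (K i * M)
    simpa using this
  filter_upwards [hsum.eventually (gt_mem_nhds (half_pos hδ0))] with j hj
  -- The form enters only after j is fixed, so the estimate is uniform over admissible forms.
  refine iSup₂_le fun ω hω => ENNReal.ofReal_le_of_le_toReal ?_
  have h1 : ∀ x, ‖ω x‖ ≤ M := fun x => by
    have h := mul_le_mul_of_nonneg_left (hω x).1 (Nat.cast_nonneg (α := ℝ) k.factorial)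
    have h' : (0 : ℝ) ≤ (k + 1).factorial := Nat.cast_nonneg _
    linarith [norm_le_comass (ω x)]
  have h2 : ∀ x, ‖extD d k ω x‖ ≤ M := fun x => by
    have h := mul_le_mul_of_nonneg_left (hω x).2 (Nat.cast_nonneg (α := ℝ) (k + 1).factorial)
    have h' : (0 : ℝ) ≤ k.factorial * l := by positivity
    linarith [norm_le_comass (extD d k ω x)]
  have h3 := (hS j).abs_le_of_translate b ρ hK0 hK (fun i => (hI i).1 j) ω h1
    (A := 2 * C * (M * r)) fun z hz =>
      ((hS j).abs_translate_sub_le_of_norm_le hC (hB j) ω z hM h1 h2).trans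
        (mul_le_mul_of_nonneg_left (mul_le_mul_of_nonneg_left hz hM) (by positivity))
  have h4 : 2 * C * (M * r) ≤ δ / 2 := by
    rw [hrdef, show 2 * C * (M * (δ / (4 * (C * M + 1)))) =
      (C * M) / (C * M + 1) * (δ / 2) by field_simp; ring]
    refine mul_le_of_le_one_left (half_pos hδ0).le ?_
    rw [div_le_one (by linarith)]
    linarith
  linarith [le_abs_self (S j ω)]

/-! ### Flat convergence implies weak* convergence. -/

theorem exists_comass_le {d k : ℕ} (ω : Form d k) : ∃ M : ℝ, 0 ≤ M ∧ ∀ x, comass (ω x) ≤ M := by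
  obtain ⟨A, hA, hA'⟩ := exists_comass_le_norm d k
  obtain ⟨M, hM⟩ := ω.continuous.bounded_above_of_compact_support ω.hasCompactSupport
  exact ⟨A * M, mul_nonneg hA.le ((norm_nonneg _).trans (hM 0)), fun x =>
    (hA' _).trans (mul_le_mul_of_nonneg_left (hM x) hA.le)⟩

/-- Every form is a multiple of an admissible form for the flat norm. -/
theorem exists_ofReal_le_mul_flatNorm {d k : ℕ} {l : ℝ} (hl : 0 < l) (ω : Form d k) :
    ∃ M : ℝ, 0 < M ∧ ∀ T : Current d k, ENNReal.ofReal (T ω) ≤ ENNReal.ofReal M * flatNorm l T := by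
  obtain ⟨M₁, h₁, h₁'⟩ := exists_comass_le ω
  obtain ⟨M₂, h₂, h₂'⟩ := exists_comass_le (extD d k ω)
  have hM : 0 < M₁ / l + M₂ + 1 := by positivity
  set M := M₁ / l + M₂ + 1 with hMdef
  refine ⟨M, hM, fun T => ?_⟩
  have h : ENNReal.ofReal (T (M⁻¹ • ω)) ≤ flatNorm l T := by
    refine le_iSup₂_of_le (M⁻¹ • ω) (fun x => ⟨?_, ?_⟩) le_rfl
    · change comass (M⁻¹ • ω x) ≤ l
      rw [comass_smul (inv_nonneg.2 hM.le), inv_mul_le_iff₀ hM]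
      have : M₁ / l * l = M₁ := div_mul_cancel₀ _ hl.ne'
      nlinarith [h₁' x, mul_nonneg h₂ hl.le]
    · rw [map_smul]
      change comass (M⁻¹ • extD d k ω x) ≤ 1
      rw [comass_smul (inv_nonneg.2 hM.le), inv_mul_le_iff₀ hM]
      have : 0 ≤ M₁ / l := by positivity
      linarith [h₂' x]
  have h' : T ω = M * T (M⁻¹ • ω) := by
    rw [map_smul, smul_eq_mul, mul_inv_cancel_left₀ hM.ne']
  rw [h', ENNReal.ofReal_mul hM.le]
  gcongr

/-- Convergence in the flat metric implies weak* convergence. -/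
theorem weakStarTendsto_of_tendsto_flatDist {d k : ℕ} {l : ℝ} (hl : 0 < l) {T : Current d k}
    {Tseq : ℕ → Current d k}
    (h : Tendsto (fun j => flatDist l T (Tseq j)) atTop (𝓝 0)) : WeakStarTendsto Tseq T := by
  have key : ∀ ω : Form d k,
      Tendsto (fun j => ENNReal.ofReal ((T - Tseq j) ω)) atTop (𝓝 0) := by
    intro ω
    obtain ⟨M, -, hM⟩ := exists_ofReal_le_mul_flatNorm hl ω
    have h' := ENNReal.Tendsto.const_mul (a := ENNReal.ofReal M) h (Or.inr ENNReal.ofReal_ne_top)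
    rw [mul_zero] at h'
    exact tendsto_of_tendsto_of_tendsto_of_le_of_le tendsto_const_nhds h' (fun _ => zero_le)
      fun j => hM _
  intro ω
  rw [Metric.tendsto_atTop']
  intro ε hε
  have h1 := (key ω).eventually (gt_mem_nhds (ENNReal.ofReal_pos.2 hε))
  -- `ENNReal.ofReal` discards negative values, so the lower bound needs -ω.
  have h2 := (key (-ω)).eventually (gt_mem_nhds (ENNReal.ofReal_pos.2 hε))
  obtain ⟨N, hN⟩ := eventually_atTop.1 (h1.and h2)
  refine ⟨N, fun j hj => ?_⟩
  obtain ⟨h3, h4⟩ := hN j hj.le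
  rw [ENNReal.ofReal_lt_ofReal_iff hε] at h3 h4
  rw [map_neg] at h4
  have h5 : (T - Tseq j) ω = T ω - Tseq j ω := rfl
  rw [Real.dist_eq, abs_lt]
  constructor <;> linarith

end GMT

end

theorem proposition2 (d k : ℕ) (X : Set (GMT.Rd d)) (hX : IsCompact X)
    (c : ℝ) (hc : 0 < c) (l : ℝ) (hl : 0 < l)
    (T : GMT.Current d k) (Tseq : ℕ → GMT.Current d k)
    (hN : ∀ j, Tseq j ∈ GMT.normalCurrents k X)
    (hb : ∀ j, GMT.mass (Tseq j) + GMT.boundaryMass (Tseq j) < ENNReal.ofReal c) :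
    Tendsto (fun j => GMT.flatDist l T (Tseq j)) atTop (𝓝 0) ↔
      GMT.WeakStarTendsto Tseq T := by
  refine ⟨GMT.weakStarTendsto_of_tendsto_flatDist hl, fun hT => ?_⟩
  obtain ⟨C, hC, hbd⟩ := GMT.exists_supBounded d k hc
  have hzero : ∀ j (ω : GMT.Form d k), Disjoint (tsupport ω) X → Tseq j ω = 0 := fun j ω h =>
    GMT.apply_eq_zero_of_disjoint_dsupport (Tseq j) ω (h.mono_right (hN j).2.2)
  have hzeroT : ∀ ω : GMT.Form d k, Disjoint (tsupport ω) X → T ω = 0 := fun ω h => by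
    have := hT ω
    simp only [hzero _ ω h] at this
    exact tendsto_nhds_unique this tendsto_const_nhds
  -- The factor 2 comes from the triangle inequality: T and each `Tseq j` both satisfy the bounds
  -- with C.
  refine GMT.tendsto_flatNorm_of_weakStarTendsto_zero hX (C := 2 * C) (by positivity) hl.le
    (S := fun j => T - Tseq j) ?_ ?_ ?_ ?_
  · exact fun j => (GMT.SupBounded.of_tendsto (fun j => (hbd _ (hb j)).1) hT).sub (hbd _ (hb j)).1
  · exact fun j =>
      (GMT.BoundarySupBounded.of_tendsto (fun j => (hbd _ (hb j)).2) hT).sub (hbd _ (hb j)).2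
  · intro j ω h
    change T ω - Tseq j ω = 0
    rw [hzero j ω h, hzeroT ω h, sub_zero]
  · intro ω
    have := (hT ω).const_sub (T ω)
    rw [sub_self] at this
    exact this
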